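/- \textbf{Theorem (Type I duality).} \emph{Network.} A multi-hop B-MAC amplify-and-forward relay network has $L$ links with sources $T_l$ and destinations $R_l$ (each having at least one antenna), and $Q\ge 1$ relay clusters. The channels are $\mathbf H_0^l$ (source $T_l$ to cluster $1$), $\mathbf H_q$, $1\le q\le Q-1$ (cluster $q$ to cluster $q+1$), and $\mathbf H_Q^l$ (cluster $Q$ to destination $R_l$). The noise covariances are $\mathbf W_q\succeq 0$ at cluster $q$ and $\mathbf W_{Q+1}^l\succ 0$ at $R_l$; the constraint matrices are $\hat{\mathbf W}_0^l\succ 0$ and $\hat{\mathbf W}_q\succeq 0$, $1\le q\le Q$; the coupling matrix $\mathbf\Phi=(\phi_{l,k})\in\{0,1\}^{L\times L}$ has $\phi_{l,l}=0$. Relay precoders $\mathbf F=(\mathbf F_1,\dots,\mathbf F_Q)$ are block diagonal, with one square block per relay of the cluster; $\hat{\mathbf F}$ below has the same block structure. Input covariances are $\mathbf\Sigma=(\mathbf\Sigma_1,\dots,\mathbf\Sigma_L)$ with $\mathbf\Sigma_l\succeq 0$. Put $$\mathbf B_{q,q'}=\mathbf F_{q'}\mathbf H_{q'-1}\mathbf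 F_{q'-1}\cdots\mathbf H_q\mathbf F_q\ (q\le q'),\qquad \check{\mathbf H}_{l,k}=\mathbf H_Q^l\mathbf B_{1,Q}\mathbf H_0^k,$$ $$\mathbf W'_l=\sum_{q=1}^Q\mathbf H_Q^l\mathbf B_{q,Q}\mathbf W_q\mathbf B_{q,Q}^\dagger\mathbf H_Q^{l\dagger}+\mathbf W_{Q+1}^l,\qquad \mathbf\Omega_l=\mathbf W'_l+\sum_k\phi_{l,k}\check{\mathbf H}_{l,k}\mathbf\Sigma_k\check{\mathbf H}_{l,k}^\dagger,$$ $$\mathbf\Sigma_q^R=\sum_l\mathbf B_{1,q}\mathbf H_0^l\mathbf\Sigma_l\mathbf H_0^{l\dagger}\mathbf B_{1,q}^\dagger+\sum_{q'=1}^q\mathbf B_{q',q}\mathbf W_{q'}\mathbf B_{q',q}^\dagger.$$ The rate of link $l$ and the network cost are $$\mathcal I_l(\mathbf\Sigma,\mathbf F)=\log\left|\mathbf I+\check{\mathbf H}_{l,l}\mathbf\Sigma_l\check{\mathbf H}_{l,l}^\dagger\mathbf\Omega_l^{-1}\right|,\qquad C(\mathbf\Sigma,\mathbf F)=\sum_l\mathrm{Tr}(\mathbf\Sigma_l\hat{\mathbf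 W}_0^l)+\sum_{q=1}^Q\mathrm{Tr}(\mathbf\Sigma_q^R\hat{\mathbf W}_q).$$ \emph{Dual network.} Directions are reversed and channels conjugate-transposed. For $\hat{\mathbf\Sigma}_l\succeq0$ and dual precoders $\hat{\mathbf F}$ put $$\hat{\mathbf B}_{q,q'}=\hat{\mathbf F}_{q'}^\dagger\mathbf H_{q'-1}\hat{\mathbf F}_{q'-1}^\dagger\cdots\mathbf H_q\hat{\mathbf F}_q^\dagger,\qquad \hat{\mathbf H}_{l,k}=\mathbf H_0^{l\dagger}\hat{\mathbf B}_{1,Q}^\dagger\mathbf H_Q^{k\dagger},$$ $$\hat{\mathbf\Omega}_l=\hat{\mathbf W}_0^l+\sum_{q=1}^Q\mathbf H_0^{l\dagger}\hat{\mathbf B}_{1,q}^\dagger\hat{\mathbf W}_q\hat{\mathbf B}_{1,q}\mathbf H_0^l+\sum_k\phi_{k,l}\hat{\mathbf H}_{l,k}\hat{\mathbf\Sigma}_k\hat{\mathbf H}_{l,k}^\dagger,$$ $$\hat{\mathbf\Sigma}_q^R=\sum_l\hat{\mathbf B}_{q,Q}^\dagger\mathbf H_Q^{l\dagger}\hat{\mathbf\Sigma}_l\mathbf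 H_Q^l\hat{\mathbf B}_{q,Q}+\sum_{q'=q}^Q\hat{\mathbf B}_{q,q'}^\dagger\hat{\mathbf W}_{q'}\hat{\mathbf B}_{q,q'},$$ $$\hat{\mathcal I}_l(\hat{\mathbf\Sigma},\hat{\mathbf F})=\log\left|\mathbf I+\hat{\mathbf H}_{l,l}\hat{\mathbf\Sigma}_l\hat{\mathbf H}_{l,l}^\dagger\hat{\mathbf\Omega}_l^{-1}\right|,\qquad \hat C(\hat{\mathbf\Sigma},\hat{\mathbf F})=\sum_l\mathrm{Tr}(\hat{\mathbf\Sigma}_l\mathbf W_{Q+1}^l)+\sum_{q=1}^Q\mathrm{Tr}(\hat{\mathbf\Sigma}_q^R\mathbf W_q).$$ \emph{Type I dual transformation.} Given $\mathbf\Sigma,\mathbf F$, put $\hat{\mathbf W}'_l=\sum_{q=1}^Q\mathbf H_0^{l\dagger}\mathbf B_{1,q}^\dagger\hat{\mathbf W}_q\mathbf B_{1,q}\mathbf H_0^l+\hat{\mathbf W}_0^l$. Decompose $\mathbf\Sigma_l=\sum_{m=1}^{M_l}p_{l,m}\mathbf t_{l,m}\mathbf t_{l,m}^\dagger$ with $p_{l,m}>0$,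 $\|\mathbf t_{l,m}\|=1$. Let $\mathbf r_{l,m}$ be a unit vector of the form $$\mathbf r_{l,m}=\alpha_{l,m}\Big(\sum_{i>m}p_{l,i}\check{\mathbf H}_{l,l}\mathbf t_{l,i}\mathbf t_{l,i}^\dagger\check{\mathbf H}_{l,l}^\dagger+\mathbf\Omega_l\Big)^{-1}\check{\mathbf H}_{l,l}\mathbf t_{l,m},\qquad \alpha_{l,m}\in\mathbb C,$$ if $\check{\mathbf H}_{l,l}\mathbf t_{l,m}\ne0$, and any unit vector otherwise. Put $g_{l,m}^{k,n}=|\mathbf r_{l,m}^\dagger\check{\mathbf H}_{l,k}\mathbf t_{k,n}|^2$, $N_{l,m}=\sum_{i>m}p_{l,i}g_{l,m}^{l,i}+\mathbf r_{l,m}^\dagger\mathbf\Omega_l\mathbf r_{l,m}$ and $\gamma_{l,m}=p_{l,m}g_{l,m}^{l,m}/N_{l,m}$ (the SINR). Let $\mathbf\Psi$ have the entries $\mathbf\Psi_{l,m}^{k,n}=0$ if $k=l$, $m\ge n$; $g_{l,m}^{l,n}$ if $k=l$, $m<n$; and $\phi_{l,k}g_{l,m}^{k,n}$ if $k\ne l$.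 Let $\mathbf D$ be diagonal with entries $\gamma_{l,m}/g_{l,m}^{l,m}$ (read as $p_{l,m}/N_{l,m}$ when $g_{l,m}^{l,m}=0$), and let $\hat n_{l,m}=\mathbf t_{l,m}^\dagger\hat{\mathbf W}'_l\mathbf t_{l,m}$. With $\mathbf q=(\mathbf D^{-1}-\mathbf\Psi^T)^{-1}\hat{\mathbf n}$, the transformation is $\hat{\mathbf\Sigma}_l=\sum_m q_{l,m}\mathbf r_{l,m}\mathbf r_{l,m}^\dagger$ together with $\hat{\mathbf F}=(\mathbf F_1^\dagger,\dots,\mathbf F_Q^\dagger)$. \emph{Claim.} Let $P_T\in\mathbb R$. For all $\mathbf\Sigma,\mathbf F$ with $C(\mathbf\Sigma,\mathbf F)=:P_T^{\mathrm{tx}}\le P_T$, a Type I dual transformation exists, and for every choice of the $M_l,p_{l,m},\mathbf t_{l,m},\mathbf r_{l,m}$ as above: $\mathbf D^{-1}-\mathbf\Psi^T$ is invertible, $\mathbf q\ge0$, $\hat{\mathbf\Sigma}_l\succeq0$, and $$\hat{\mathcal I}_l(\hat{\mathbf\Sigma},\hat{\mathbf F})\ge\mathcal I_l(\mathbf\Sigma,\mathbf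 F)\quad(1\le l\le L),\qquad \hat C(\hat{\mathbf\Sigma},\hat{\mathbf F})=P_T^{\mathrm{tx}}.$$ Consequently the achievable regions coincide: $$\bigcup_{\mathbf\Sigma\succeq0,\,\mathbf F:\ C(\mathbf\Sigma,\mathbf F)\le P_T}\{\boldsymbol\rho\in\mathbb R_{\ge0}^L:\rho_l\le\mathcal I_l(\mathbf\Sigma,\mathbf F)\ \forall l\}=\bigcup_{\hat{\mathbf\Sigma}\succeq0,\,\hat{\mathbf F}:\ \hat C(\hat{\mathbf\Sigma},\hat{\mathbf F})\le P_T}\{\boldsymbol\rho\in\mathbb R_{\ge0}^L:\rho_l\le\hat{\mathcal I}_l(\hat{\mathbf\Sigma},\hat{\mathbf F})\ \forall l\}.$$ -/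

import Mathlib

open Matrix
open scoped ComplexOrder

noncomputable section

/-! ### One-hop B-MAC interference networks and the covariance transformation -/

/-- Parameters `([H_{l,k}], [W_l], [Ŵ_l])` and coupling matrix `Φ` of a one-hop B-MAC interference
network with `L` links; link `l` has `tx l` transmit and `rx l` receive antennas. -/
structure IFN {L : ℕ} (tx rx : Fin L → ℕ) where
  /-- channel from the transmitter of link `k` to the receiver of link `l` -/
  H : ∀ l k, Matrix (Fin (rx l)) (Fin (tx k)) ℂ
  /-- noise covariance at the receiver of link `l` -/
  W : ∀ l, Matrix (Fin (rx l)) (Fin (rx l)) ℂ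
  /-- matrix of the linear constraint on the input covariance of link `l` -/
  What : ∀ l, Matrix (Fin (tx l)) (Fin (tx l)) ℂ
  /-- coupling matrix -/
  Φ : Matrix (Fin L) (Fin L) ℝ

/-- One square matrix per link, of the size given by the number of antennas. -/
abbrev Covariances {L : ℕ} (ant : Fin L → ℕ) : Type :=
  ∀ l, Matrix (Fin (ant l)) (Fin (ant l)) ℂ

namespace IFN

variable {L : ℕ} {tx rx : Fin L → ℕ}

/-- Interference-plus-noise covariance of link `l`. -/
def Omega (net : IFN tx rx) (S : Covariances tx) (l : Fin L) :
    Matrix (Fin (rx l)) (Fin (rx l)) ℂ :=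
  net.W l + ∑ k, net.Φ l k • (net.H l k * S k * (net.H l k)ᴴ)

end IFN

/-- Steps 1 and 2 of the covariance transformation: a decomposition of every `S l` into streams with
unit transmit vectors `t` and positive powers `p`, with the unit-length MMSE-SIC receive vectors
`r`. A stream whose signal does not reach its receiver (`H_{l,l} t = 0`) has no MMSE direction; its
receive vector may then be any unit vector. -/
structure Streams {L : ℕ} {tx rx : Fin L → ℕ} (net : IFN tx rx) (S : Covariances tx) where
  /-- number of streams of each link -/
  M : Fin L → ℕ
  /-- transmit powers -/
  p : ∀ l, Fin (M l) → ℝ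
  /-- transmit vectors -/
  t : ∀ l, Fin (M l) → Fin (tx l) → ℂ
  /-- receive vectors -/
  r : ∀ l, Fin (M l) → Fin (rx l) → ℂ
  p_pos : ∀ l m, 0 < p l m
  t_unit : ∀ l m, star (t l m) ⬝ᵥ t l m = 1
  decomp : ∀ l, S l = ∑ m, p l m • vecMulVec (t l m) (star (t l m))
  r_unit : ∀ l m, star (r l m) ⬝ᵥ r l m = 1
  r_mmse : ∀ l m, net.H l l *ᵥ t l m ≠ 0 → ∃ α : ℂ, r l m = α •
    ((∑ i ∈ Finset.univ.filter (fun i => m < i),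
        net.H l l * (p l i • vecMulVec (t l i) (star (t l i))) * (net.H l l)ᴴ
      + net.Omega S l)⁻¹ *ᵥ (net.H l l *ᵥ t l m))

namespace Streams

variable {L : ℕ} {tx rx : Fin L → ℕ} {net : IFN tx rx} {S : Covariances tx}

/-- The squared magnitude `|r_{l,m}† H_{l,k} t_{k,n}|²`. -/
def gain (st : Streams net S) (a b : Σ l, Fin (st.M l)) : ℝ :=
  Complex.normSq (star (st.r a.1 a.2) ⬝ᵥ (net.H a.1 b.1 *ᵥ st.t b.1 b.2))

/-- Power of interference plus noise seen by stream `a = (l, m)` after its receive filter: the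
streams `i > m` of the same link, and the interference from other links and noise. -/
def interference (st : Streams net S) (a : Σ l, Fin (st.M l)) : ℝ :=
  ∑ i ∈ Finset.univ.filter (fun i => a.2 < i), st.p a.1 i * st.gain a ⟨a.1, i⟩
    + (star (st.r a.1 a.2) ⬝ᵥ (net.Omega S a.1 *ᵥ st.r a.1 a.2)).re

/-- The SINR `γ_{l,m}`. -/
def sinr (st : Streams net S) (a : Σ l, Fin (st.M l)) : ℝ :=
  st.p a.1 a.2 * st.gain a a / st.interference a

/-- The cross-talk matrix `Ψ`. -/
def Psi (st : Streams net S) : Matrix (Σ l, Fin (st.M l)) (Σ l, Fin (st.M l)) ℝ :=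
  fun a b =>
    if a.1 = b.1 then (if a.2.val < b.2.val then st.gain a b else 0)
    else net.Φ a.1 b.1 * st.gain a b

/-- The diagonal matrix `D` with entries `γ_{l,m} / |r_{l,m}† H_{l,l} t_{l,m}|²`. For a stream of
zero gain this quotient is `0 / 0`, and it is given the value `p_{l,m} / (interference + noise)`,
which the quotient has for every stream of non-zero gain. -/
def D (st : Streams net S) : Matrix (Σ l, Fin (st.M l)) (Σ l, Fin (st.M l)) ℝ :=
  Matrix.diagonal fun a =>
    if st.gain a a = 0 then st.p a.1 a.2 / st.interference a else st.sinr a / st.gain a a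

/-- The vector `n̂` with entries `t_{l,m}† Ŵ_l t_{l,m}`. -/
def nhat (st : Streams net S) (a : Σ l, Fin (st.M l)) : ℝ :=
  (star (st.t a.1 a.2) ⬝ᵥ (net.What a.1 *ᵥ st.t a.1 a.2)).re

/-- The reverse transmit powers `q = (D⁻¹ - Ψᵀ)⁻¹ n̂`. -/
def q (st : Streams net S) : (Σ l, Fin (st.M l)) → ℝ :=
  (st.D⁻¹ - st.Psiᵀ)⁻¹ *ᵥ st.nhat

/-- The covariance transformation `Σ̂_l = ∑ₘ q_{l,m} r_{l,m} r_{l,m}†`. -/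
def covTransform (st : Streams net S) : Covariances rx :=
  fun l => ∑ m, st.q ⟨l, m⟩ • vecMulVec (st.r l m) (star (st.r l m))

end Streams

/-! ### Multi-hop B-MAC amplify-and-forward relay networks -/

/-- The antennas of relay cluster `q`: relay `j` of the cluster has `ant q j` antennas. -/
abbrev ClusterAnt {n : ℕ} {relays : Fin (n + 1) → ℕ} (ant : ∀ q, Fin (relays q) → ℕ)
    (q : Fin (n + 1)) : Type :=
  Σ j : Fin (relays q), Fin (ant q j)

/-- A B-MAC AF relay network with `L` links and `Q = n + 1 ≥ 1` relay clusters, numbered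
`0, …, n` (so `0` is the cluster next to the sources and `Fin.last n` is the one next to the
destinations), with the matrices `Ŵ` of its single network linear constraint. -/
structure RelayNetwork {L n : ℕ} (tx rx : Fin L → ℕ) {relays : Fin (n + 1) → ℕ}
    (ant : ∀ q, Fin (relays q) → ℕ) where
  /-- channel from the source of link `l` to the first cluster -/
  Hsrc : ∀ l, Matrix (ClusterAnt ant 0) (Fin (tx l)) ℂ
  /-- channel from each cluster to the next one -/
  H : ∀ i : Fin n, Matrix (ClusterAnt ant i.succ) (ClusterAnt ant i.castSucc) ℂ
  /-- channel from the last cluster to the destination of link `l` -/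
  Hdst : ∀ l, Matrix (Fin (rx l)) (ClusterAnt ant (Fin.last n)) ℂ
  /-- noise covariance at each cluster -/
  W : ∀ q, Matrix (ClusterAnt ant q) (ClusterAnt ant q) ℂ
  /-- noise covariance at the destination of link `l` -/
  Wdst : ∀ l, Matrix (Fin (rx l)) (Fin (rx l)) ℂ
  /-- constraint matrix of the source of link `l` -/
  Whatsrc : ∀ l, Matrix (Fin (tx l)) (Fin (tx l)) ℂ
  /-- constraint matrix of each cluster -/
  What : ∀ q, Matrix (ClusterAnt ant q) (ClusterAnt ant q) ℂ
  /-- coupling matrix -/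
  Φ : Matrix (Fin L) (Fin L) ℝ
  tx_pos : ∀ l, 0 < tx l
  rx_pos : ∀ l, 0 < rx l
  W_psd : ∀ q, (W q).PosSemidef
  Wdst_pd : ∀ l, (Wdst l).PosDef
  Whatsrc_pd : ∀ l, (Whatsrc l).PosDef
  What_psd : ∀ q, (What q).PosSemidef
  Φ_binary : ∀ l k, Φ l k = 0 ∨ Φ l k = 1
  Φ_diag : ∀ l, Φ l l = 0

/-- Relay precoding matrices: one square matrix for every relay of every cluster. -/
abbrev Precoders {n : ℕ} {relays : Fin (n + 1) → ℕ} (ant : ∀ q, Fin (relays q) → ℕ) : Type :=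
  ∀ q, ∀ j : Fin (relays q), Matrix (Fin (ant q j)) (Fin (ant q j)) ℂ

namespace Precoders

variable {n : ℕ} {relays : Fin (n + 1) → ℕ} {ant : ∀ q, Fin (relays q) → ℕ}

/-- The composite block-diagonal precoding matrix `F_q` of cluster `q`. -/
def composite (F : Precoders ant) (q : Fin (n + 1)) :
    Matrix (ClusterAnt ant q) (ClusterAnt ant q) ℂ :=
  Matrix.blockDiagonal' (F q)

/-- The precoders with every matrix replaced by its conjugate transpose. -/
def adjoint (F : Precoders ant) : Precoders ant :=
  fun q j => (F q j)ᴴ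

theorem composite_adjoint (F : Precoders ant) (q : Fin (n + 1)) :
    (adjoint F).composite q = (F.composite q)ᴴ :=
  (Matrix.blockDiagonal'_conjTranspose (F q)).symm

end Precoders

namespace RelayNetwork

variable {L n : ℕ} {tx rx : Fin L → ℕ} {relays : Fin (n + 1) → ℕ}
  {ant : ∀ q, Fin (relays q) → ℕ}

/-- The product `G_{q'} H_{q'-1} G_{q'-1} ⋯ H_q G_q` for `q ≤ q'` (and `0` for `q > q'`). -/
def chain (N : RelayNetwork tx rx ant)
    (G : ∀ q, Matrix (ClusterAnt ant q) (ClusterAnt ant q) ℂ) (q q' : Fin (n + 1)) :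
    Matrix (ClusterAnt ant q') (ClusterAnt ant q) ℂ :=
  Fin.induction (motive := fun q' => Matrix (ClusterAnt ant q') (ClusterAnt ant q) ℂ)
    (if h : 0 = q then h ▸ G 0 else 0)
    (fun i P => if h : i.succ = q then h ▸ G i.succ else G i.succ * N.H i * P) q'

theorem chain_self (N : RelayNetwork tx rx ant)
    (G : ∀ q, Matrix (ClusterAnt ant q) (ClusterAnt ant q) ℂ) (q : Fin (n + 1)) :
    N.chain G q q = G q := by
  induction q using Fin.cases <;> simp [chain]

theorem chain_succ (N : RelayNetwork tx rx ant)
    (G : ∀ q, Matrix (ClusterAnt ant q) (ClusterAnt ant q) ℂ) (q : Fin (n + 1)) (i : Fin n)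
    (h : q ≤ i.castSucc) :
    N.chain G q i.succ = G i.succ * N.H i * N.chain G q i.castSucc := by
  have h' : i.succ ≠ q := by
    rintro rfl
    exact absurd h (by simp [Fin.le_def])
  simp [chain, h']

/-! #### The network itself -/

/-- `B_{q,q'} = F_{q'} H_{q'-1} F_{q'-1} ⋯ H_q F_q`. -/
def B (N : RelayNetwork tx rx ant) (F : Precoders ant) (q q' : Fin (n + 1)) :
    Matrix (ClusterAnt ant q') (ClusterAnt ant q) ℂ :=
  N.chain F.composite q q'

/-- The end-to-end channel from the source of link `k` to the destination of link `l`. -/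
def Hcheck (N : RelayNetwork tx rx ant) (F : Precoders ant) (l k : Fin L) :
    Matrix (Fin (rx l)) (Fin (tx k)) ℂ :=
  N.Hdst l * N.B F 0 (Fin.last n) * N.Hsrc k

/-- Covariance `Σ_q^R` of the signal transmitted by cluster `q`. -/
def SigmaR (N : RelayNetwork tx rx ant) (S : Covariances tx) (F : Precoders ant)
    (q : Fin (n + 1)) : Matrix (ClusterAnt ant q) (ClusterAnt ant q) ℂ :=
  ∑ l, N.B F 0 q * N.Hsrc l * S l * (N.Hsrc l)ᴴ * (N.B F 0 q)ᴴ
    + ∑ q' ∈ Finset.Iic q, N.B F q' q * N.W q' * (N.B F q' q)ᴴ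

/-- Covariance `W'_l` of the accumulated noise at the destination of link `l`. -/
def Wprime (N : RelayNetwork tx rx ant) (F : Precoders ant) (l : Fin L) :
    Matrix (Fin (rx l)) (Fin (rx l)) ℂ :=
  ∑ q, N.Hdst l * N.B F q (Fin.last n) * N.W q * (N.B F q (Fin.last n))ᴴ * (N.Hdst l)ᴴ
    + N.Wdst l

/-- Interference-plus-noise covariance at the destination of link `l`. -/
def Omega (N : RelayNetwork tx rx ant) (S : Covariances tx) (F : Precoders ant) (l : Fin L) :
    Matrix (Fin (rx l)) (Fin (rx l)) ℂ :=
  N.Wprime F l + ∑ k, N.Φ l k • (N.Hcheck F l k * S k * (N.Hcheck F l k)ᴴ)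

/-- Achievable rate of link `l` (the determinant is a positive real number). -/
def rate (N : RelayNetwork tx rx ant) (S : Covariances tx) (F : Precoders ant) (l : Fin L) : ℝ :=
  Real.log (1 + N.Hcheck F l l * S l * (N.Hcheck F l l)ᴴ * (N.Omega S F l)⁻¹).det.re

/-- The left-hand side of the single network linear constraint. -/
def cost (N : RelayNetwork tx rx ant) (S : Covariances tx) (F : Precoders ant) : ℝ :=
  ∑ l, (S l * N.Whatsrc l).trace.re + ∑ q, (N.SigmaR S F q * N.What q).trace.re

/-- The achievable region under the single network linear constraint with bound `PT`. -/
def region (N : RelayNetwork tx rx ant) (PT : ℝ) : Set (Fin L → ℝ) :=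
  {ρ | (∀ l, 0 ≤ ρ l) ∧ ∃ (S : Covariances tx) (F : Precoders ant),
    (∀ l, (S l).PosSemidef) ∧ N.cost S F ≤ PT ∧ ∀ l, ρ l ≤ N.rate S F l}

/-! #### The dual network

The transmission directions are reversed, with the clusters keeping their numbers: the destination
of link `l` transmits, its signal passes through the clusters `n, …, 0` and reaches the source of
link `l`. Channel matrices are replaced by their conjugate transposes, the noise covariances are
the matrices `What` and `Whatsrc`, the constraint matrices are `W` and `Wdst`, and the coupling
matrix is the transpose of `Φ`. -/

/-- `B̂_{q,q'} = F̂_{q'}† H_{q'-1} F̂_{q'-1}† ⋯ H_q F̂_q†`. -/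
def dualB (N : RelayNetwork tx rx ant) (Fh : Precoders ant) (q q' : Fin (n + 1)) :
    Matrix (ClusterAnt ant q') (ClusterAnt ant q) ℂ :=
  N.chain (fun q => (Fh.composite q)ᴴ) q q'

/-- The end-to-end channel of the dual network, from the destination of link `k` to the source of
link `l`. -/
def dualH (N : RelayNetwork tx rx ant) (Fh : Precoders ant) (l k : Fin L) :
    Matrix (Fin (tx l)) (Fin (rx k)) ℂ :=
  (N.Hsrc l)ᴴ * (N.dualB Fh 0 (Fin.last n))ᴴ * (N.Hdst k)ᴴ

/-- Covariance of the signal transmitted by cluster `q` in the dual network. -/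
def dualSigmaR (N : RelayNetwork tx rx ant) (Sh : Covariances rx) (Fh : Precoders ant)
    (q : Fin (n + 1)) : Matrix (ClusterAnt ant q) (ClusterAnt ant q) ℂ :=
  ∑ l, (N.dualB Fh q (Fin.last n))ᴴ * (N.Hdst l)ᴴ * Sh l * N.Hdst l * N.dualB Fh q (Fin.last n)
    + ∑ q' ∈ Finset.Ici q, (N.dualB Fh q q')ᴴ * N.What q' * N.dualB Fh q q'

/-- Interference-plus-noise covariance at the source of link `l` in the dual network. -/
def dualOmega (N : RelayNetwork tx rx ant) (Sh : Covariances rx) (Fh : Precoders ant)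
    (l : Fin L) : Matrix (Fin (tx l)) (Fin (tx l)) ℂ :=
  N.Whatsrc l + ∑ q, (N.Hsrc l)ᴴ * (N.dualB Fh 0 q)ᴴ * N.What q * N.dualB Fh 0 q * N.Hsrc l
    + ∑ k, N.Φ k l • (N.dualH Fh l k * Sh k * (N.dualH Fh l k)ᴴ)

/-- Achievable rate of link `l` in the dual network. -/
def dualRate (N : RelayNetwork tx rx ant) (Sh : Covariances rx) (Fh : Precoders ant)
    (l : Fin L) : ℝ :=
  Real.log (1 + N.dualH Fh l l * Sh l * (N.dualH Fh l l)ᴴ * (N.dualOmega Sh Fh l)⁻¹).det.re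

/-- The left-hand side of the single network linear constraint of the dual network. -/
def dualCost (N : RelayNetwork tx rx ant) (Sh : Covariances rx) (Fh : Precoders ant) : ℝ :=
  ∑ l, (Sh l * N.Wdst l).trace.re + ∑ q, (N.dualSigmaR Sh Fh q * N.W q).trace.re

/-- The achievable region of the dual network under its single network linear constraint. -/
def dualRegion (N : RelayNetwork tx rx ant) (PT : ℝ) : Set (Fin L → ℝ) :=
  {ρ | (∀ l, 0 ≤ ρ l) ∧ ∃ (Sh : Covariances rx) (Fh : Precoders ant),
    (∀ l, (Sh l).PosSemidef) ∧ N.dualCost Sh Fh ≤ PT ∧ ∀ l, ρ l ≤ N.dualRate Sh Fh l}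

/-! #### The equivalent one-hop network -/

/-- The constraint matrices `Ŵ'_l` of the equivalent one-hop network. -/
def Whatprime (N : RelayNetwork tx rx ant) (F : Precoders ant) (l : Fin L) :
    Matrix (Fin (tx l)) (Fin (tx l)) ℂ :=
  ∑ q, (N.Hsrc l)ᴴ * (N.B F 0 q)ᴴ * N.What q * N.B F 0 q * N.Hsrc l + N.Whatsrc l

/-- The B-MAC interference network equivalent to the relay network with fixed precoders `F`. The
Type I dual transformation of `S, F` is formed by `st.covTransform`, for streams
`st : Streams (N.equivalentIFN F) S`, and by `F.adjoint`. -/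
def equivalentIFN (N : RelayNetwork tx rx ant) (F : Precoders ant) : IFN tx rx where
  H := N.Hcheck F
  W := N.Wprime F
  What := N.Whatprime F
  Φ := N.Φ

end RelayNetwork

end

/-! ### Hermitian forms and determinants of positive definite matrices -/

section Forms

variable {m n ι : Type*} [Fintype n]

/-! For fixed relay precoders the relay network is a one-hop interference network, and its cost is
the one-hop linear cost plus `noiseCost`, which depends on `F` only. With `F̂ = F†` the dual relay
network reduces in the same way to the dual one-hop network, with the same additive term (`cost_eq`,
`dualCost_adjoint`). Hence everything follows from duality of one-hop networks.

There, MMSE reception with successive cancellation loses nothing: a rate is the sum of `log (1 +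
sinr)` over the streams (`rate_eq`). The SINR equations read `(D⁻¹ - Ψ) p = n`, with `n` the
filtered noise. Since `p > 0`, `n > 0` and `Ψ ≥ 0`, the matrix is an M-matrix: it is invertible with
nonnegative inverse, so `(D⁻¹ - Ψᵀ) q = n̂` has a solution `q ≥ 0`. Pairing the two systems gives
`qᵀ n = pᵀ n̂`, the equality of costs (`sum_q_mul_noise`).

The system for `q` says that in the dual network, with the `t` as receive filters and the reverse
decoding order, every SINR is the same as before. Optimal reception is at least as good by
Cauchy-Schwarz, so no rate decreases (`rate_le_dual_rate`). Applied to the dual network, the same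
argument gives the reverse inclusion of regions. -/

theorem mul_smul_vecMulVec_mul_conjTranspose (A : Matrix m n ℂ) (p : ℝ) (t : n → ℂ) :
    A * (p • vecMulVec t (star t)) * Aᴴ = p • vecMulVec (A *ᵥ t) (star (A *ᵥ t)) := by
  rw [Matrix.mul_smul, Matrix.smul_mul, mul_vecMulVec, vecMulVec_mul, star_mulVec]

theorem mul_sum_smul_vecMulVec_mul_conjTranspose (s : Finset ι) (A : Matrix m n ℂ) (p : ι → ℝ)
    (t : ι → n → ℂ) :
    A * (∑ i ∈ s, p i • vecMulVec (t i) (star (t i))) * Aᴴ =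
      ∑ i ∈ s, p i • vecMulVec (A *ᵥ t i) (star (A *ᵥ t i)) := by
  rw [Matrix.mul_sum, Matrix.sum_mul]
  exact Finset.sum_congr rfl fun i _ => mul_smul_vecMulVec_mul_conjTranspose A (p i) (t i)

theorem star_dotProduct_comm_star (v w : n → ℂ) : star w ⬝ᵥ v = star (star v ⬝ᵥ w) := by
  rw [star_dotProduct]

theorem normSq_star_dotProduct_comm (v w : n → ℂ) :
    Complex.normSq (star v ⬝ᵥ w) = Complex.normSq (star w ⬝ᵥ v) := by
  rw [star_dotProduct_comm_star w v]
  exact Complex.normSq_conj _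

theorem normSq_star_dotProduct_conjTranspose_mulVec [Fintype m] (A : Matrix m n ℂ) (v : n → ℂ) (w : m → ℂ) :
    Complex.normSq (star v ⬝ᵥ (Aᴴ *ᵥ w)) = Complex.normSq (star w ⬝ᵥ (A *ᵥ v)) := by
  rw [normSq_star_dotProduct_comm w, star_mulVec, ← dotProduct_mulVec]

theorem re_form_smul_vecMulVec (p : ℝ) (v h : n → ℂ) :
    (star v ⬝ᵥ ((p • vecMulVec h (star h)) *ᵥ v)).re = p * Complex.normSq (star v ⬝ᵥ h) := by
  rw [smul_mulVec, vecMulVec_mulVec, dotProduct_smul, op_smul_eq_smul, dotProduct_smul,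
    star_dotProduct_comm_star v h, smul_eq_mul, Complex.real_smul, Complex.re_ofReal_mul]
  congr 1
  rw [← Complex.ofReal_re (Complex.normSq _), ← Complex.mul_conj, mul_comm]
  rfl

theorem re_form_sum_smul_vecMulVec (s : Finset ι) (p : ι → ℝ) (v : n → ℂ) (h : ι → n → ℂ) :
    (star v ⬝ᵥ ((∑ i ∈ s, p i • vecMulVec (h i) (star (h i))) *ᵥ v)).re =
      ∑ i ∈ s, p i * Complex.normSq (star v ⬝ᵥ h i) := by
  rw [sum_mulVec, dotProduct_sum, Complex.re_sum]
  exact Finset.sum_congr rfl fun i _ => re_form_smul_vecMulVec (p i) v (h i)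

theorem posSemidef_sum_smul_vecMulVec (s : Finset ι) (p : ι → ℝ) (h : ι → n → ℂ)
    (hp : ∀ i, 0 ≤ p i) :
    (∑ i ∈ s, p i • vecMulVec (h i) (star (h i))).PosSemidef :=
  posSemidef_sum s fun i _ => (posSemidef_vecMulVec_self_star (h i)).smul (hp i)

theorem ne_zero_of_star_dotProduct_self {v : n → ℂ} (hv : star v ⬝ᵥ v = 1) : v ≠ 0 := by
  rintro rfl
  simp at hv

theorem Matrix.PosDef.re_form_pos {C : Matrix n n ℂ} (hC : C.PosDef) {v : n → ℂ} (hv : v ≠ 0) :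
    0 < (star v ⬝ᵥ (C *ᵥ v)).re :=
  (Complex.pos_iff.1 (hC.dotProduct_mulVec_pos hv)).1

theorem Matrix.PosSemidef.re_form_nonneg {C : Matrix n n ℂ} (hC : C.PosSemidef) (v : n → ℂ) :
    0 ≤ (star v ⬝ᵥ (C *ᵥ v)).re :=
  (Complex.nonneg_iff.1 (hC.dotProduct_mulVec_nonneg v)).1

theorem Matrix.PosSemidef.form_eq_re {C : Matrix n n ℂ} (hC : C.PosSemidef) (v : n → ℂ) :
    star v ⬝ᵥ (C *ᵥ v) = ((star v ⬝ᵥ (C *ᵥ v)).re : ℂ) :=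
  Complex.ext rfl (by
    rw [Complex.ofReal_im]
    exact (Complex.nonneg_iff.1 (hC.dotProduct_mulVec_nonneg v)).2.symm)

variable [DecidableEq n]

theorem Matrix.PosDef.inv_mulVec_mulVec {C : Matrix n n ℂ} (hC : C.PosDef) (v : n → ℂ) :
    C *ᵥ (C⁻¹ *ᵥ v) = v := by
  rw [mulVec_mulVec, mul_nonsing_inv _ ((isUnit_iff_isUnit_det C).1 hC.isUnit), one_mulVec]

/-- Cauchy-Schwarz for the form of a positive definite matrix and the form of its inverse. -/
theorem Matrix.PosDef.normSq_star_dotProduct_le {C : Matrix n n ℂ} (hC : C.PosDef)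
    {x : n → ℂ} (hx : x ≠ 0) (y : n → ℂ) :
    Complex.normSq (star x ⬝ᵥ y) / (star x ⬝ᵥ (C *ᵥ x)).re ≤ (star y ⬝ᵥ (C⁻¹ *ᵥ y)).re := by
  have hpos := hC.re_form_pos hx
  set a := (star x ⬝ᵥ (C *ᵥ x)).re with ha
  set s := star x ⬝ᵥ y with hs
  have hxx : star x ⬝ᵥ (C *ᵥ x) = (a : ℂ) := hC.posSemidef.form_eq_re x
  set z := C⁻¹ *ᵥ y with hz
  have hCz : C *ᵥ z = y := hC.inv_mulVec_mulVec y
  have hzx : star z ⬝ᵥ (C *ᵥ x) = star s := by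
    rw [dotProduct_mulVec]
    nth_rw 1 [← hC.isHermitian.eq]
    rw [← star_mulVec, hCz, hs, star_dotProduct]
  have hyz : star z ⬝ᵥ y = star (star y ⬝ᵥ z) := star_dotProduct_comm_star y z
  -- `(s / a) • x` is the projection of `z` onto `x` in the inner product of `C`; the form of the
  -- residual is the Cauchy-Schwarz defect.
  have key := hC.posSemidef.re_form_nonneg (z - (s / a) • x)
  have expand : star (z - (s / a) • x) ⬝ᵥ (C *ᵥ (z - (s / a) • x)) =
      star (star y ⬝ᵥ z) - (Complex.normSq s / a : ℝ) := by
    have ha0 : (a : ℂ) ≠ 0 := by exact_mod_cast hpos.ne'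
    rw [mulVec_sub, mulVec_smul, hCz, star_sub, star_smul, sub_dotProduct, dotProduct_sub,
      dotProduct_sub, smul_dotProduct, smul_dotProduct, dotProduct_smul, dotProduct_smul,
      hzx, hxx, hyz, ← hs]
    have h1 : star (s / (a : ℂ)) = star s / a := by simp
    simp only [smul_eq_mul, h1]
    rw [Complex.ofReal_div, ← Complex.mul_conj]
    change _ = _ - s * star s / a
    field_simp
    ring
  rw [expand] at key
  simp only [Complex.sub_re, Complex.ofReal_re, Complex.star_def, Complex.conj_re] at key
  linarith

/-- The matrix determinant lemma; the `1 × 1` determinant is real because `C⁻¹` is Hermitian. -/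
theorem Matrix.PosDef.det_add_smul_vecMulVec {C : Matrix n n ℂ} (hC : C.PosDef) (p : ℝ)
    (h : n → ℂ) :
    (C + p • vecMulVec h (star h)).det =
      C.det * ((1 + p * (star h ⬝ᵥ (C⁻¹ *ᵥ h)).re : ℝ) : ℂ) := by
  have hu := (isUnit_iff_isUnit_det C).1 hC.isUnit
  rw [← smul_vecMulVec, vecMulVec_eq Unit, det_add_replicateCol_mul_replicateRow hu]
  congr 1
  rw [det_unique, Complex.ofReal_add, Complex.ofReal_mul, ← hC.inv.posSemidef.form_eq_re h]
  simp only [add_apply, one_apply_eq, Complex.ofReal_one]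
  congr 1
  rw [Matrix.mul_assoc, ← replicateCol_mulVec]
  change star h ⬝ᵥ (C⁻¹ *ᵥ (p • h)) = _
  rw [mulVec_smul, dotProduct_smul]
  simp

end Forms

/-! ### Chain rule for the log-determinant. -/

section LogDet

variable {n ι : Type*} [Fintype n] [DecidableEq n] [LinearOrder ι]

theorem Matrix.PosDef.det_add_sum_smul_vecMulVec {C : Matrix n n ℂ} (hC : C.PosDef) {p : ι → ℝ}
    (hp : ∀ i, 0 ≤ p i) (h : ι → n → ℂ) (s : Finset ι) :
    (C + ∑ i ∈ s, p i • vecMulVec (h i) (star (h i))).det =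
      C.det * ((∏ m ∈ s, (1 + p m * (star (h m) ⬝ᵥ
        ((∑ i ∈ s.filter (· < m), p i • vecMulVec (h i) (star (h i)) + C)⁻¹ *ᵥ h m)).re) : ℝ) :
          ℂ) := by
  -- Adding the indices in increasing order leaves the sets of predecessors of the earlier ones
  -- unchanged.
  induction s using Finset.induction_on_max with
  | empty => simp
  | insert a s hs ih =>
    have ha : a ∉ s := fun h => lt_irrefl a (hs a h)
    have hC' := PosDef.posSemidef_add (posSemidef_sum_smul_vecMulVec s p h hp) hC
    have hfa : (insert a s).filter (· < a) = s := by
      rw [Finset.filter_insert, if_neg (lt_irrefl a), Finset.filter_true_of_mem hs]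
    rw [Finset.sum_insert ha, Finset.prod_insert ha, hfa, add_comm (_ • _), ← add_assoc,
      add_comm C, hC'.det_add_smul_vecMulVec, add_comm _ C, ih, Complex.ofReal_mul, mul_assoc,
      mul_comm ((∏ _ ∈ _, _ : ℝ) : ℂ)]
    congr 3
    refine Finset.prod_congr rfl fun m hm => ?_
    rw [Finset.filter_insert, if_neg (hs m hm).not_gt]

/-- The log-determinant of a sum of rank-one signals splits over the signals, each of them
being received in the presence of its predecessors. -/
theorem Matrix.PosDef.log_det_one_add_sum [Fintype ι] {C : Matrix n n ℂ} (hC : C.PosDef)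
    {p : ι → ℝ} (hp : ∀ i, 0 ≤ p i) (h : ι → n → ℂ) :
    Real.log (1 + (∑ i, p i • vecMulVec (h i) (star (h i))) * C⁻¹).det.re =
      ∑ m, Real.log (1 + p m * (star (h m) ⬝ᵥ
        ((∑ i ∈ Finset.univ.filter (· < m), p i • vecMulVec (h i) (star (h i)) + C)⁻¹ *ᵥ
          h m)).re) := by
  have hu := (isUnit_iff_isUnit_det C).1 hC.isUnit
  have h1 : 1 + (∑ i, p i • vecMulVec (h i) (star (h i))) * C⁻¹ =
      (C + ∑ i, p i • vecMulVec (h i) (star (h i))) * C⁻¹ := by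
    rw [Matrix.add_mul, mul_nonsing_inv _ hu]
  rw [h1, det_mul, hC.det_add_sum_smul_vecMulVec hp, mul_right_comm, ← det_mul,
    mul_nonsing_inv _ hu, det_one, one_mul, Complex.ofReal_re, Real.log_prod]
  intro m _
  have := PosDef.posSemidef_add (posSemidef_sum_smul_vecMulVec (Finset.univ.filter (· < m)) p h hp) hC
  have := mul_nonneg (hp m) (this.inv.posSemidef.re_form_nonneg (h m))
  positivity

/-- As `Matrix.PosDef.log_det_one_add_sum`, in the opposite order. -/
theorem Matrix.PosDef.log_det_one_add_sum' [Fintype ι] {C : Matrix n n ℂ} (hC : C.PosDef)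
    {p : ι → ℝ} (hp : ∀ i, 0 ≤ p i) (h : ι → n → ℂ) :
    Real.log (1 + (∑ i, p i • vecMulVec (h i) (star (h i))) * C⁻¹).det.re =
      ∑ m, Real.log (1 + p m * (star (h m) ⬝ᵥ
        ((∑ i ∈ Finset.univ.filter (m < ·), p i • vecMulVec (h i) (star (h i)) + C)⁻¹ *ᵥ
          h m)).re) :=
  hC.log_det_one_add_sum (ι := ιᵒᵈ) (p := p) hp h

end LogDet

/-! ### M-matrices: invertibility and nonnegative inverse. -/

section MMatrix

variable {ι : Type*} [Fintype ι] [DecidableEq ι]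

/-- Take `b` minimizing `x b / p b`. If the minimum `c` were negative, then `x ≥ c p` with equality
at `b` and `A ≥ 0` would bound row `b` of `(diagonal d - A) x` by `c` times that of `(diagonal d -
A) p`, which is negative. -/
theorem nonneg_of_mulVec_nonneg {d p : ι → ℝ} {A : Matrix ι ι ℝ} (hp : ∀ a, 0 < p a)
    (hA : ∀ a b, 0 ≤ A a b) (h : ∀ a, 0 < ((diagonal d - A) *ᵥ p) a) {x : ι → ℝ}
    (hx : ∀ a, 0 ≤ ((diagonal d - A) *ᵥ x) a) (a : ι) : 0 ≤ x a := by
  have : Nonempty ι := ⟨a⟩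
  obtain ⟨b, hb⟩ := Finite.exists_min fun a => x a / p a
  by_contra! hneg
  have hc : x b / p b < 0 := (hb a).trans_lt (div_neg_of_neg_of_pos hneg (hp a))
  set c := x b / p b with hcd
  have hxb : x b = c * p b := by rw [hcd, div_mul_cancel₀ _ (hp b).ne']
  have hle : ∀ e, c * p e ≤ x e := fun e => (le_div_iff₀ (hp e)).1 (hb e)
  have h1 := hx b
  have h2 := h b
  rw [sub_mulVec, Pi.sub_apply, mulVec_diagonal] at h1 h2
  have h3 : c * (A *ᵥ p) b ≤ (A *ᵥ x) b := by
    simp only [mulVec, dotProduct, Finset.mul_sum]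
    refine Finset.sum_le_sum fun e _ => ?_
    calc c * (A b e * p e) = A b e * (c * p e) := by ring
      _ ≤ A b e * x e := mul_le_mul_of_nonneg_left (hle e) (hA b e)
  rw [hxb] at h1
  have h4 : c * (d b * p b - (A *ᵥ p) b) < 0 := mul_neg_of_neg_of_pos hc h2
  nlinarith

/-- A matrix with nonpositive off-diagonal part which maps some positive vector to a positive
vector is invertible. -/
theorem isUnit_diagonal_sub {d p : ι → ℝ} {A : Matrix ι ι ℝ} (hp : ∀ a, 0 < p a)
    (hA : ∀ a b, 0 ≤ A a b) (h : ∀ a, 0 < ((diagonal d - A) *ᵥ p) a) :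
    IsUnit (diagonal d - A) := by
  rw [← mulVec_injective_iff_isUnit]
  refine (injective_iff_map_eq_zero (diagonal d - A).mulVecLin).2 fun x hx => ?_
  rw [mulVecLin_apply] at hx
  funext a
  refine le_antisymm ?_ (nonneg_of_mulVec_nonneg hp hA h (fun b => by rw [hx]; rfl) a)
  have := nonneg_of_mulVec_nonneg hp hA h (x := -x) (fun b => by rw [mulVec_neg, hx]; simp) a
  simpa using this

/-- Each column of the inverse is the preimage of a nonnegative basis vector. -/
theorem inv_diagonal_sub_nonneg {d p : ι → ℝ} {A : Matrix ι ι ℝ} (hp : ∀ a, 0 < p a)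
    (hA : ∀ a b, 0 ≤ A a b) (h : ∀ a, 0 < ((diagonal d - A) *ᵥ p) a) (a b : ι) :
    0 ≤ (diagonal d - A)⁻¹ a b := by
  have hu := (isUnit_iff_isUnit_det _).1 (isUnit_diagonal_sub hp hA h)
  have := nonneg_of_mulVec_nonneg hp hA h (x := (diagonal d - A)⁻¹ *ᵥ Pi.single b 1)
    (fun e => by
      rw [mulVec_mulVec, mul_nonsing_inv _ hu, one_mulVec, Pi.single_apply]
      split <;> simp) a
  simpa using this

end MMatrix

/-! ### Duality of one-hop networks -/

namespace IFN

variable {L : ℕ} {tx rx : Fin L → ℕ}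

/-- The network with reversed links, conjugate transposed channels, and the noise covariances
exchanged with the constraint matrices. -/
def dual (net : IFN tx rx) : IFN rx tx where
  H l k := (net.H k l)ᴴ
  W := net.What
  What := net.W
  Φ := net.Φᵀ

/-- This lets the reverse inclusion of regions follow from the forward one. -/
theorem dual_dual (net : IFN tx rx) : net.dual.dual = net := by
  cases net
  simp [dual]

/-- The rate of link `l`. -/
noncomputable def rate (net : IFN tx rx) (S : Covariances tx) (l : Fin L) : ℝ :=
  Real.log (1 + net.H l l * S l * (net.H l l)ᴴ * (net.Omega S l)⁻¹).det.re

/-- The left-hand side of the linear constraint. -/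
noncomputable def cost (net : IFN tx rx) (S : Covariances tx) : ℝ :=
  ∑ l, (S l * net.What l).trace.re

/-- Noise covariances and constraint matrices are positive definite, and the coupling matrix is
nonnegative with zero diagonal. -/
structure Regular (net : IFN tx rx) : Prop where
  W_pd : ∀ l, (net.W l).PosDef
  What_pd : ∀ l, (net.What l).PosDef
  Φ_nonneg : ∀ l k, 0 ≤ net.Φ l k
  Φ_diag : ∀ l, net.Φ l l = 0

theorem Regular.dual {net : IFN tx rx} (hN : net.Regular) : net.dual.Regular :=
  ⟨hN.What_pd, hN.W_pd, fun l k => hN.Φ_nonneg k l, hN.Φ_diag⟩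

theorem Regular.posDef_Omega {net : IFN tx rx} (hN : net.Regular) {S : Covariances tx}
    (hS : ∀ l, (S l).PosSemidef) (l : Fin L) : (net.Omega S l).PosDef :=
  (hN.W_pd l).add_posSemidef <| posSemidef_sum _ fun k _ =>
    ((hS k).mul_mul_conjTranspose_same (net.H l k)).smul (hN.Φ_nonneg l k)

/-- Powers and vectors are arbitrary because the formula serves twice: for `p, t` in the network and
for `q, r` in its dual, where the `t` need not be MMSE receive vectors. -/
theorem re_form_Omega (net : IFN tx rx) {M : Fin L → ℕ} (p : ∀ l, Fin (M l) → ℝ)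
    (t : ∀ l, Fin (M l) → Fin (tx l) → ℂ) (l : Fin L) (v : Fin (rx l) → ℂ) :
    (star v ⬝ᵥ (net.Omega (fun k => ∑ m, p k m • vecMulVec (t k m) (star (t k m))) l *ᵥ v)).re =
      (star v ⬝ᵥ (net.W l *ᵥ v)).re +
        ∑ k, ∑ m, net.Φ l k * (p k m * Complex.normSq (star v ⬝ᵥ (net.H l k *ᵥ t k m))) := by
  rw [Omega, add_mulVec, dotProduct_add, Complex.add_re, sum_mulVec, dotProduct_sum,
    Complex.re_sum]
  congr 1
  refine Finset.sum_congr rfl fun k _ => ?_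
  rw [smul_mulVec, dotProduct_smul, Complex.real_smul, Complex.re_ofReal_mul,
    mul_sum_smul_vecMulVec_mul_conjTranspose, re_form_sum_smul_vecMulVec, Finset.mul_sum]

theorem trace_sum_smul_vecMulVec_mul {n ι : Type*} [Fintype n] [Fintype ι] (p : ι → ℝ)
    (t : ι → n → ℂ) (W : Matrix n n ℂ) :
    ((∑ m, p m • vecMulVec (t m) (star (t m))) * W).trace.re =
      ∑ m, p m * (star (t m) ⬝ᵥ (W *ᵥ t m)).re := by
  rw [Matrix.sum_mul, trace_sum, Complex.re_sum]
  refine Finset.sum_congr rfl fun m _ => ?_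
  rw [Matrix.smul_mul, trace_smul, Complex.real_smul, Complex.re_ofReal_mul, trace_mul_comm,
    mul_vecMulVec, trace_vecMulVec, dotProduct_comm]

end IFN

/-! ### Power balance of the streams and the covariance transformation. -/

namespace Streams

variable {L : ℕ} {tx rx : Fin L → ℕ} {net : IFN tx rx} {S : Covariances tx}

theorem posSemidef (st : Streams net S) (l : Fin L) : (S l).PosSemidef := by
  rw [st.decomp]
  exact posSemidef_sum_smul_vecMulVec _ _ _ fun m => (st.p_pos l m).le

theorem eq_sum (st : Streams net S) :
    S = fun l => ∑ m, st.p l m • vecMulVec (st.t l m) (star (st.t l m)) :=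
  funext st.decomp

theorem posDef_Omega (st : Streams net S) (hN : net.Regular) (l : Fin L) :
    (net.Omega S l).PosDef :=
  hN.posDef_Omega st.posSemidef l

/-- The powers as a function on all streams. -/
def power (st : Streams net S) (a : Σ l, Fin (st.M l)) : ℝ := st.p a.1 a.2

/-- Noise power after the receive filter of a stream. -/
def noise (st : Streams net S) (a : Σ l, Fin (st.M l)) : ℝ :=
  (star (st.r a.1 a.2) ⬝ᵥ (net.W a.1 *ᵥ st.r a.1 a.2)).re

theorem power_pos (st : Streams net S) (a : Σ l, Fin (st.M l)) : 0 < st.power a :=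
  st.p_pos a.1 a.2

theorem gain_nonneg (st : Streams net S) (a b : Σ l, Fin (st.M l)) : 0 ≤ st.gain a b :=
  Complex.normSq_nonneg _

theorem noise_pos (st : Streams net S) (hN : net.Regular) (a : Σ l, Fin (st.M l)) :
    0 < st.noise a :=
  (hN.W_pd a.1).re_form_pos (ne_zero_of_star_dotProduct_self (st.r_unit a.1 a.2))

theorem nhat_pos (st : Streams net S) (hN : net.Regular) (a : Σ l, Fin (st.M l)) :
    0 < st.nhat a :=
  (hN.What_pd a.1).re_form_pos (ne_zero_of_star_dotProduct_self (st.t_unit a.1 a.2))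

theorem interference_pos (st : Streams net S) (hN : net.Regular) (a : Σ l, Fin (st.M l)) :
    0 < st.interference a :=
  add_pos_of_nonneg_of_pos
    (Finset.sum_nonneg fun i _ => mul_nonneg (st.p_pos a.1 i).le (st.gain_nonneg _ _))
    ((st.posDef_Omega hN a.1).re_form_pos (ne_zero_of_star_dotProduct_self (st.r_unit a.1 a.2)))

theorem sinr_nonneg (st : Streams net S) (hN : net.Regular) (a : Σ l, Fin (st.M l)) :
    0 ≤ st.sinr a :=
  div_nonneg (mul_nonneg (st.p_pos _ _).le (st.gain_nonneg _ _)) (st.interference_pos hN a).le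

theorem Psi_nonneg (st : Streams net S) (hN : net.Regular) (a b : Σ l, Fin (st.M l)) :
    0 ≤ st.Psi a b := by
  unfold Psi
  split_ifs
  · exact st.gain_nonneg _ _
  · exact le_rfl
  · exact mul_nonneg (hN.Φ_nonneg _ _) (st.gain_nonneg _ _)

/-- As `Φ` vanishes on the diagonal, the inter-link term can be kept for all pairs; sums against `Ψ`
then contain the full interference sum of `Omega`. -/
theorem Psi_eq_add (st : Streams net S) (hN : net.Regular) (a b : Σ l, Fin (st.M l)) :
    st.Psi a b = (if a.1 = b.1 ∧ a.2.val < b.2.val then st.gain a b else 0) +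
      net.Φ a.1 b.1 * st.gain a b := by
  unfold Psi
  by_cases h : a.1 = b.1
  · simp [h, hN.Φ_diag]
  · simp [h]

/-- The condition `P` is on natural numbers because the stream indices of different links have
different types. -/
theorem sum_ite_same_link {M : Fin L → ℕ} (a : Σ l, Fin (M l)) (P : ℕ → Prop) [DecidablePred P]
    (f : (Σ l, Fin (M l)) → ℝ) :
    ∑ b, (if a.1 = b.1 ∧ P b.2.val then f b else 0) =
      ∑ i ∈ Finset.univ.filter (fun i : Fin (M a.1) => P i.val), f ⟨a.1, i⟩ := by
  rw [Fintype.sum_sigma, Finset.sum_eq_single a.1, Finset.sum_filter]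
  · simp
  · intro k _ hk
    simp [hk.symm]
  · simp

theorem Psi_mulVec (st : Streams net S) (hN : net.Regular) (x : (Σ l, Fin (st.M l)) → ℝ)
    (a : Σ l, Fin (st.M l)) :
    (st.Psi *ᵥ x) a = ∑ i ∈ Finset.univ.filter (fun i => a.2 < i),
        x ⟨a.1, i⟩ * st.gain a ⟨a.1, i⟩ +
      ∑ k, ∑ m, net.Φ a.1 k * (x ⟨k, m⟩ * st.gain a ⟨k, m⟩) := by
  simp only [mulVec, dotProduct, st.Psi_eq_add hN, add_mul, Finset.sum_add_distrib, ite_mul,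
    zero_mul]
  rw [sum_ite_same_link a (fun i => a.2.val < i) (fun b => st.gain a b * x b), Fintype.sum_sigma]
  congr 1
  · exact Finset.sum_congr rfl fun i _ => mul_comm _ _
  · exact Finset.sum_congr rfl fun k _ => Finset.sum_congr rfl fun m _ => by ring

/-- Transposing turns the interferers `i > m` into `i < m`: the dual network decodes in the reverse
order. -/
theorem Psi_transpose_mulVec (st : Streams net S) (hN : net.Regular)
    (x : (Σ l, Fin (st.M l)) → ℝ) (a : Σ l, Fin (st.M l)) :
    (st.Psiᵀ *ᵥ x) a = ∑ i ∈ Finset.univ.filter (fun i => i < a.2),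
        x ⟨a.1, i⟩ * st.gain ⟨a.1, i⟩ a +
      ∑ k, ∑ m, net.Φ k a.1 * (x ⟨k, m⟩ * st.gain ⟨k, m⟩ a) := by
  simp only [mulVec, dotProduct, transpose_apply, st.Psi_eq_add hN, add_mul,
    Finset.sum_add_distrib, ite_mul, zero_mul]
  simp only [eq_comm (b := a.1)]
  rw [sum_ite_same_link a (fun i => i < a.2.val) (fun b => st.gain b a * x b), Fintype.sum_sigma]
  congr 1
  · exact Finset.sum_congr rfl fun i _ => mul_comm _ _
  · exact Finset.sum_congr rfl fun k _ => Finset.sum_congr rfl fun m _ => by ring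

/-- Balance of the received powers. -/
theorem interference_eq (st : Streams net S) (hN : net.Regular) (a : Σ l, Fin (st.M l)) :
    st.interference a = (st.Psi *ᵥ st.power) a + st.noise a := by
  have h := net.re_form_Omega st.p st.t a.1 (st.r a.1 a.2)
  rw [← st.eq_sum] at h
  rw [interference, h, st.Psi_mulVec hN]
  simp only [power, noise, gain]
  ring

/-- The convention at zero gain makes the entry of `D` equal to power over interference for every
stream. -/
theorem D_inv (st : Streams net S) (hN : net.Regular) :
    st.D⁻¹ = diagonal fun a => st.interference a / st.power a := by
  refine inv_eq_right_inv ?_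
  rw [D, diagonal_mul_diagonal, ← diagonal_one]
  congr 1
  funext a
  have h1 := (st.interference_pos hN a).ne'
  have h2 := (st.power_pos a).ne'
  rw [power] at h2 ⊢
  split_ifs with h
  · field_simp
  · rw [sinr]
    field_simp

/-- The positive vectors `power` and `noise` certify that `D⁻¹ - Ψ` is an M-matrix; its transpose
inherits invertibility and the sign of the inverse. -/
theorem mulVec_power (st : Streams net S) (hN : net.Regular) :
    (st.D⁻¹ - st.Psi) *ᵥ st.power = st.noise := by
  funext a
  rw [st.D_inv hN, sub_mulVec, Pi.sub_apply, mulVec_diagonal,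
    div_mul_cancel₀ _ (st.power_pos a).ne', st.interference_eq hN]
  ring

theorem transpose_sub (st : Streams net S) (hN : net.Regular) :
    st.D⁻¹ - st.Psiᵀ = (st.D⁻¹ - st.Psi)ᵀ := by
  rw [Matrix.transpose_sub, st.D_inv hN, diagonal_transpose]

theorem isUnit_sub (st : Streams net S) (hN : net.Regular) : IsUnit (st.D⁻¹ - st.Psiᵀ) := by
  rw [st.transpose_sub hN, isUnit_transpose]
  have h := st.mulVec_power hN
  rw [st.D_inv hN] at h ⊢
  exact isUnit_diagonal_sub st.power_pos (st.Psi_nonneg hN) fun a => by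
    rw [h]; exact st.noise_pos hN a

theorem q_nonneg (st : Streams net S) (hN : net.Regular) (a : Σ l, Fin (st.M l)) :
    0 ≤ st.q a := by
  rw [q, st.transpose_sub hN, ← transpose_nonsing_inv]
  have h := st.mulVec_power hN
  rw [st.D_inv hN] at h ⊢
  refine Finset.sum_nonneg fun b _ => mul_nonneg ?_ (st.nhat_pos hN b).le
  exact inv_diagonal_sub_nonneg st.power_pos (st.Psi_nonneg hN)
    (fun a => by rw [h]; exact st.noise_pos hN a) b a

theorem mulVec_q (st : Streams net S) (hN : net.Regular) :
    (st.D⁻¹ - st.Psiᵀ) *ᵥ st.q = st.nhat := by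
  rw [q, mulVec_mulVec, mul_nonsing_inv _ ((isUnit_iff_isUnit_det _).1 (st.isUnit_sub hN)),
    one_mulVec]

theorem posSemidef_covTransform (st : Streams net S) (hN : net.Regular) (l : Fin L) :
    (st.covTransform l).PosSemidef :=
  posSemidef_sum_smul_vecMulVec _ _ _ fun m => st.q_nonneg hN ⟨l, m⟩

/-- Both sides equal `qᵀ (D⁻¹ - Ψ) p`. -/
theorem sum_q_mul_noise (st : Streams net S) (hN : net.Regular) :
    ∑ a, st.q a * st.noise a = ∑ a, st.power a * st.nhat a := by
  change st.q ⬝ᵥ st.noise = st.power ⬝ᵥ st.nhat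
  rw [← st.mulVec_power hN, ← st.mulVec_q hN, st.transpose_sub hN, dotProduct_mulVec,
    mulVec_transpose, dotProduct_comm]

theorem cost_eq (st : Streams net S) : net.cost S = ∑ a, st.power a * st.nhat a := by
  rw [IFN.cost, Fintype.sum_sigma]
  refine Finset.sum_congr rfl fun l _ => ?_
  rw [st.decomp, IFN.trace_sum_smul_vecMulVec_mul]
  rfl

/-- The covariance transformation preserves the value of the linear constraint. -/
theorem dual_cost_covTransform (st : Streams net S) (hN : net.Regular) :
    net.dual.cost st.covTransform = net.cost S := by
  rw [st.cost_eq, ← st.sum_q_mul_noise hN, IFN.cost, Fintype.sum_sigma]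
  refine Finset.sum_congr rfl fun l _ => ?_
  rw [covTransform, IFN.trace_sum_smul_vecMulVec_mul]
  rfl

/-- The SINR is attained by the minimum mean square error receive vector. -/
theorem power_mul_form_eq_sinr (st : Streams net S) (hN : net.Regular)
    (a : Σ l, Fin (st.M l)) :
    st.p a.1 a.2 * (star (net.H a.1 a.1 *ᵥ st.t a.1 a.2) ⬝ᵥ
      ((∑ i ∈ Finset.univ.filter (fun i => a.2 < i), st.p a.1 i •
          vecMulVec (net.H a.1 a.1 *ᵥ st.t a.1 i) (star (net.H a.1 a.1 *ᵥ st.t a.1 i)) +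
        net.Omega S a.1)⁻¹ *ᵥ (net.H a.1 a.1 *ᵥ st.t a.1 a.2))).re = st.sinr a := by
  have hC := PosDef.posSemidef_add (posSemidef_sum_smul_vecMulVec
    (Finset.univ.filter (fun i => a.2 < i)) (st.p a.1) (fun i => net.H a.1 a.1 *ᵥ st.t a.1 i)
    fun i => (st.p_pos a.1 i).le) (st.posDef_Omega hN a.1)
  have hI : st.interference a = (star (st.r a.1 a.2) ⬝ᵥ
      ((∑ i ∈ Finset.univ.filter (fun i => a.2 < i), st.p a.1 i •
          vecMulVec (net.H a.1 a.1 *ᵥ st.t a.1 i) (star (net.H a.1 a.1 *ᵥ st.t a.1 i)) +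
        net.Omega S a.1) *ᵥ st.r a.1 a.2)).re := by
    rw [add_mulVec, dotProduct_add, Complex.add_re, re_form_sum_smul_vecMulVec]
    rfl
  have hr := st.r_mmse a.1 a.2
  simp only [mul_smul_vecMulVec_mul_conjTranspose] at hr
  have hpos := st.interference_pos hN a
  rw [sinr, gain]
  rw [hI] at hpos ⊢
  set C := ∑ i ∈ Finset.univ.filter (fun i => a.2 < i), st.p a.1 i •
          vecMulVec (net.H a.1 a.1 *ᵥ st.t a.1 i) (star (net.H a.1 a.1 *ᵥ st.t a.1 i)) +
        net.Omega S a.1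
  set h := net.H a.1 a.1 *ᵥ st.t a.1 a.2
  by_cases h0 : h = 0
  -- Without a received signal both sides vanish, whichever unit vector `r` is.
  · simp [h0]
  obtain ⟨α, hα⟩ := hr h0
  rw [hα] at hpos ⊢
  -- With `f = h† C⁻¹ h` the gain is `|α|² f²` and the interference `|α|² f`, so `α` cancels in the
  -- SINR.
  have hf : star (C⁻¹ *ᵥ h) ⬝ᵥ h = ((star h ⬝ᵥ (C⁻¹ *ᵥ h)).re : ℂ) := by
    rw [star_dotProduct_comm_star h, hC.inv.posSemidef.form_eq_re h]
    simp
  have hq : (star (α • (C⁻¹ *ᵥ h)) ⬝ᵥ (C *ᵥ (α • (C⁻¹ *ᵥ h)))).re =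
      Complex.normSq α * (star h ⬝ᵥ (C⁻¹ *ᵥ h)).re := by
    rw [mulVec_smul, hC.inv_mulVec_mulVec, star_smul, smul_dotProduct, dotProduct_smul, hf,
      smul_eq_mul, smul_eq_mul, ← mul_assoc, Complex.star_def, mul_comm (starRingEnd ℂ α),
      Complex.mul_conj, ← Complex.ofReal_mul, Complex.ofReal_re]
  rw [hq] at hpos ⊢
  rw [star_smul, smul_dotProduct, hf, smul_eq_mul, Complex.normSq_mul, Complex.star_def,
    Complex.normSq_conj, Complex.normSq_ofReal]
  rw [eq_div_iff hpos.ne']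
  ring

theorem rate_eq (st : Streams net S) (hN : net.Regular) (l : Fin L) :
    net.rate S l = ∑ m, Real.log (1 + st.sinr ⟨l, m⟩) := by
  have h := (st.posDef_Omega hN l).log_det_one_add_sum' (fun m => (st.p_pos l m).le)
    fun m => net.H l l *ᵥ st.t l m
  rw [IFN.rate, st.decomp l, mul_sum_smul_vecMulVec_mul_conjTranspose, h]
  exact Finset.sum_congr rfl fun m _ => by rw [← st.power_mul_form_eq_sinr hN ⟨l, m⟩]

/-- Balance of the powers received in the dual network with the receive vectors `t`. -/
theorem form_dual_eq (st : Streams net S) (hN : net.Regular) (a : Σ l, Fin (st.M l)) :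
    (star (st.t a.1 a.2) ⬝ᵥ
      ((∑ i ∈ Finset.univ.filter (· < a.2), st.q ⟨a.1, i⟩ •
          vecMulVec (net.dual.H a.1 a.1 *ᵥ st.r a.1 i) (star (net.dual.H a.1 a.1 *ᵥ st.r a.1 i)) +
        net.dual.Omega st.covTransform a.1) *ᵥ st.t a.1 a.2)).re =
      st.interference a / st.power a * st.q a := by
  have h := congrFun (st.mulVec_q hN) a
  rw [st.D_inv hN, sub_mulVec, Pi.sub_apply, mulVec_diagonal, sub_eq_iff_eq_add] at h
  have h' := net.dual.re_form_Omega (fun l m => st.q ⟨l, m⟩) st.r a.1 (st.t a.1 a.2)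
  rw [h, st.Psi_transpose_mulVec hN, add_mulVec, dotProduct_add, Complex.add_re,
    re_form_sum_smul_vecMulVec]
  unfold covTransform
  rw [h']
  simp only [IFN.dual, normSq_star_dotProduct_conjTranspose_mulVec, gain, nhat, transpose_apply]
  ring

/-- The covariance transformation does not decrease any rate. -/
theorem rate_le_dual_rate (st : Streams net S) (hN : net.Regular) (l : Fin L) :
    net.rate S l ≤ net.dual.rate st.covTransform l := by
  have hΩ := hN.dual.posDef_Omega (st.posSemidef_covTransform hN) l
  -- The order is opposite to that of `rate_eq`, to match `Ψᵀ`.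
  have h := hΩ.log_det_one_add_sum (fun m => st.q_nonneg hN ⟨l, m⟩)
    fun m => net.dual.H l l *ᵥ st.r l m
  rw [st.rate_eq hN, IFN.rate]
  nth_rw 1 [covTransform]
  rw [mul_sum_smul_vecMulVec_mul_conjTranspose, h]
  refine Finset.sum_le_sum fun m _ => Real.log_le_log ?_ ?_
  · linarith [st.sinr_nonneg hN ⟨l, m⟩]
  have ht := ne_zero_of_star_dotProduct_self (st.t_unit l m)
  have hC := PosDef.posSemidef_add (posSemidef_sum_smul_vecMulVec
    (Finset.univ.filter (· < m)) (fun i => st.q ⟨l, i⟩) (fun i => net.dual.H l l *ᵥ st.r l i)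
    fun i => st.q_nonneg hN ⟨l, i⟩) hΩ
  -- `t` is a possibly suboptimal receive filter for the dual stream.
  have hcs := hC.normSq_star_dotProduct_le ht (net.dual.H l l *ᵥ st.r l m)
  have hpos := hC.re_form_pos ht
  rw [st.form_dual_eq hN ⟨l, m⟩] at hcs hpos
  have hq := mul_le_mul_of_nonneg_left hcs (st.q_nonneg hN ⟨l, m⟩)
  refine (add_le_add_iff_left 1).2 (le_trans (le_of_eq ?_) hq)
  have hg : Complex.normSq (star (st.t l m) ⬝ᵥ (net.dual.H l l *ᵥ st.r l m)) =
      st.gain ⟨l, m⟩ ⟨l, m⟩ := normSq_star_dotProduct_conjTranspose_mulVec _ _ _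
  have h1 := (st.interference_pos hN ⟨l, m⟩).ne'
  have h2 := (st.power_pos ⟨l, m⟩).ne'
  -- The interference behind the filter `t` is positive and has `q` as a factor, so `q` cancels and
  -- the original SINR remains.
  have h3 : st.q ⟨l, m⟩ ≠ 0 := right_ne_zero_of_mul hpos.ne'
  rw [hg, sinr]
  change st.power ⟨l, m⟩ * _ / _ = _
  field_simp

end Streams

/-! ### Existence of stream decompositions -/

theorem exists_smul_unit {n : Type*} [Fintype n] {v : n → ℂ} (hv : v ≠ 0) :
    ∃ c : ℝ, 0 < c ∧ star (c • v) ⬝ᵥ (c • v) = 1 := by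
  have h := dotProduct_star_self_pos_iff.2 hv
  obtain ⟨h1, h2⟩ := Complex.pos_iff.1 h
  refine ⟨(√(star v ⬝ᵥ v).re)⁻¹, by positivity, ?_⟩
  have hre : star v ⬝ᵥ v = ((star v ⬝ᵥ v).re : ℂ) := Complex.ext rfl (by simpa using h2.symm)
  rw [star_smul, smul_dotProduct, dotProduct_smul, hre, smul_smul, star_trivial, ← mul_inv,
    Complex.ofReal_re, Real.mul_self_sqrt h1.le, Complex.real_smul, ← Complex.ofReal_mul,
    inv_mul_cancel₀ h1.ne', Complex.ofReal_one]

theorem Matrix.PosSemidef.exists_eq_sum_unit_vecMulVec {n : Type*} [Fintype n] {A : Matrix n n ℂ}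
    (hA : A.PosSemidef) :
    ∃ (M : ℕ) (p : Fin M → ℝ) (t : Fin M → n → ℂ), (∀ m, 0 < p m) ∧
      (∀ m, star (t m) ⬝ᵥ t m = 1) ∧ A = ∑ m, p m • vecMulVec (t m) (star (t m)) := by
  obtain ⟨m, v, hv⟩ := posSemidef_iff_eq_sum_vecMulVec.1 hA
  -- Zero vectors cannot be normalized and are dropped.
  let e := (Finset.univ.filter fun i => v i ≠ 0).equivFin.symm
  have he : ∀ i, v (e i) ≠ 0 := fun i => (Finset.mem_filter.1 (e i).2).2
  choose c hc hu using fun i => exists_smul_unit (he i)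
  refine ⟨_, fun i => (c i * c i)⁻¹, fun i => c i • v (e i),
    fun i => inv_pos.2 (mul_pos (hc i) (hc i)), hu, ?_⟩
  have hsum : ∀ i, (c i * c i)⁻¹ • vecMulVec (c i • v (e i)) (star (c i • v (e i))) =
      vecMulVec (v (e i)) (star (v (e i))) := fun i => by
    rw [star_smul, star_trivial, smul_vecMulVec, vecMulVec_smul, smul_smul, smul_smul,
      mul_assoc, inv_mul_cancel₀ (mul_pos (hc i) (hc i)).ne', one_smul]
  rw [hv, Finset.sum_congr rfl fun i _ => hsum i,
    e.sum_comp fun i => vecMulVec (v i) (star (v i)),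
    Finset.sum_coe_sort (Finset.univ.filter fun i => v i ≠ 0)
      fun i => vecMulVec (v i) (star (v i))]
  refine (Finset.sum_filter_of_ne fun i _ h => ?_).symm
  rintro h0
  simp [h0] at h

theorem IFN.Regular.nonempty_streams {L : ℕ} {tx rx : Fin L → ℕ} {net : IFN tx rx}
    (hN : net.Regular) (hrx : ∀ l, 0 < rx l) {S : Covariances tx}
    (hS : ∀ l, (S l).PosSemidef) : Nonempty (Streams net S) := by
  choose M p t hp ht hd using fun l => (hS l).exists_eq_sum_unit_vecMulVec
  have hr : ∀ l m, ∃ r : Fin (rx l) → ℂ, star r ⬝ᵥ r = 1 ∧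
      (net.H l l *ᵥ t l m ≠ 0 → ∃ α : ℂ, r = α •
        ((∑ i ∈ Finset.univ.filter (fun i => m < i),
          net.H l l * (p l i • vecMulVec (t l i) (star (t l i))) * (net.H l l)ᴴ
            + net.Omega S l)⁻¹ *ᵥ (net.H l l *ᵥ t l m))) := by
    intro l m
    by_cases h : net.H l l *ᵥ t l m = 0
    -- A unit vector exists because the receiver has an antenna.
    · exact ⟨Pi.single ⟨0, hrx l⟩ 1, by simp, fun h' => absurd h h'⟩
    · have hC := PosDef.posSemidef_add (posSemidef_sum_smul_vecMulVec
        (Finset.univ.filter (fun i => m < i)) (p l) (fun i => net.H l l *ᵥ t l i)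
        fun i => (hp l i).le) (hN.posDef_Omega hS l)
      simp only [mul_smul_vecMulVec_mul_conjTranspose]
      obtain ⟨c, -, hc⟩ := exists_smul_unit (v := (∑ i ∈ Finset.univ.filter (fun i => m < i),
        p l i • vecMulVec (net.H l l *ᵥ t l i) (star (net.H l l *ᵥ t l i))
          + net.Omega S l)⁻¹ *ᵥ (net.H l l *ᵥ t l m)) fun h0 => h <| by
            rw [← hC.inv_mulVec_mulVec (net.H l l *ᵥ t l m), h0, mulVec_zero]
      exact ⟨_, hc, fun _ => ⟨c, by ext; simp⟩⟩
  choose r hr1 hr2 using hr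
  exact ⟨⟨M, p, t, r, hp, ht, hd, hr1, hr2⟩⟩

/-! ### Relay networks and their equivalent one-hop networks -/

theorem Precoders.adjoint_adjoint {n : ℕ} {relays : Fin (n + 1) → ℕ}
    {ant : ∀ q, Fin (relays q) → ℕ} (F : Precoders ant) : F.adjoint.adjoint = F := by
  funext q j
  exact conjTranspose_conjTranspose _

namespace RelayNetwork

variable {L n : ℕ} {tx rx : Fin L → ℕ} {relays : Fin (n + 1) → ℕ}
  {ant : ∀ q, Fin (relays q) → ℕ}

theorem regular_equivalentIFN (N : RelayNetwork tx rx ant) (F : Precoders ant) :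
    (N.equivalentIFN F).Regular where
  W_pd l := PosDef.posSemidef_add (posSemidef_sum _ fun q _ => by
    simpa only [conjTranspose_mul, Matrix.mul_assoc] using
      (N.W_psd q).mul_mul_conjTranspose_same (N.Hdst l * N.B F q (Fin.last n))) (N.Wdst_pd l)
  What_pd l := PosDef.posSemidef_add (posSemidef_sum _ fun q _ => by
    simpa only [conjTranspose_mul, Matrix.mul_assoc] using
      (N.What_psd q).conjTranspose_mul_mul_same (N.B F 0 q * N.Hsrc l)) (N.Whatsrc_pd l)
  Φ_nonneg l k := by
    rcases N.Φ_binary l k with h | h <;> simp [equivalentIFN, h]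
  Φ_diag := N.Φ_diag

theorem dualB_adjoint (N : RelayNetwork tx rx ant) (F : Precoders ant) (q q' : Fin (n + 1)) :
    N.dualB F.adjoint q q' = N.B F q q' := by
  simp only [dualB, B, Precoders.composite_adjoint, conjTranspose_conjTranspose]

theorem dualH_adjoint (N : RelayNetwork tx rx ant) (F : Precoders ant) (l k : Fin L) :
    N.dualH F.adjoint l k = (N.Hcheck F k l)ᴴ := by
  rw [dualH, dualB_adjoint, Hcheck, conjTranspose_mul, conjTranspose_mul, Matrix.mul_assoc]

theorem dualOmega_adjoint (N : RelayNetwork tx rx ant) (Sh : Covariances rx) (F : Precoders ant)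
    (l : Fin L) : N.dualOmega Sh F.adjoint l = (N.equivalentIFN F).dual.Omega Sh l := by
  simp only [dualOmega, dualH_adjoint, dualB_adjoint]
  rw [add_comm (N.Whatsrc l)]
  rfl

theorem dualRate_adjoint (N : RelayNetwork tx rx ant) (Sh : Covariances rx) (F : Precoders ant)
    (l : Fin L) : N.dualRate Sh F.adjoint l = (N.equivalentIFN F).dual.rate Sh l := by
  rw [dualRate, dualOmega_adjoint, dualH_adjoint]
  rfl

/-- The part of the cost due to the relay noise transmitted by the clusters. -/
noncomputable def noiseCost (N : RelayNetwork tx rx ant) (F : Precoders ant) : ℝ :=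
  ∑ q, ∑ q' ∈ Finset.Iic q, (N.B F q' q * N.W q' * (N.B F q' q)ᴴ * N.What q).trace.re

/-- Cyclicity of the trace moves the relay chains from the source signals onto the constraint
matrices, which assembles `Whatprime`. -/
theorem cost_eq (N : RelayNetwork tx rx ant) (S : Covariances tx) (F : Precoders ant) :
    N.cost S F = (N.equivalentIFN F).cost S + N.noiseCost F := by
  have h : ∀ l q, (N.B F 0 q * N.Hsrc l * S l * (N.Hsrc l)ᴴ * (N.B F 0 q)ᴴ * N.What q).trace =
      (S l * ((N.Hsrc l)ᴴ * (N.B F 0 q)ᴴ * N.What q * N.B F 0 q * N.Hsrc l)).trace := by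
    intro l q
    rw [Matrix.mul_assoc (_ * _ * _), Matrix.mul_assoc (_ * _ * _), Matrix.mul_assoc (_ * _),
      trace_mul_comm]
    simp only [Matrix.mul_assoc]
  simp only [cost, noiseCost, IFN.cost, SigmaR, equivalentIFN, Whatprime, Matrix.add_mul,
    Matrix.mul_add, Matrix.sum_mul, Matrix.mul_sum, trace_add, trace_sum, Complex.add_re,
    Complex.re_sum, Finset.sum_add_distrib, h]
  rw [Finset.sum_comm (s := Finset.univ (α := Fin L))]
  ring

/-- The additive term is that of `cost_eq`: the noise of cluster `q` weighted at cluster `q' ≥ q`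
contributes the same trace in both directions, and the two double sums run over the same pairs. -/
theorem dualCost_adjoint (N : RelayNetwork tx rx ant) (Sh : Covariances rx) (F : Precoders ant) :
    N.dualCost Sh F.adjoint = (N.equivalentIFN F).dual.cost Sh + N.noiseCost F := by
  have h : ∀ l q, ((N.B F q (Fin.last n))ᴴ * (N.Hdst l)ᴴ * Sh l * N.Hdst l *
      N.B F q (Fin.last n) * N.W q).trace =
      (Sh l * (N.Hdst l * N.B F q (Fin.last n) * N.W q * (N.B F q (Fin.last n))ᴴ *
        (N.Hdst l)ᴴ)).trace := by
    intro l q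
    rw [Matrix.mul_assoc (_ * _ * _), Matrix.mul_assoc (_ * _ * _), Matrix.mul_assoc (_ * _),
      trace_mul_comm]
    simp only [Matrix.mul_assoc]
  have h' : ∀ q q', ((N.B F q q')ᴴ * N.What q' * N.B F q q' * N.W q).trace =
      (N.B F q q' * N.W q * (N.B F q q')ᴴ * N.What q').trace := by
    intro q q'
    rw [Matrix.mul_assoc (_ * _), trace_mul_comm]
    simp only [Matrix.mul_assoc]
  simp only [dualCost, noiseCost, IFN.cost, dualSigmaR, dualB_adjoint, equivalentIFN, IFN.dual,
    Wprime, Matrix.add_mul, Matrix.mul_add, Matrix.sum_mul, Matrix.mul_sum, trace_add, trace_sum,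
    Complex.add_re, Complex.re_sum, Finset.sum_add_distrib, h, h']
  rw [Finset.sum_comm (s := Finset.univ (α := Fin L)),
    Finset.sum_comm' (s := Finset.univ) (t := Finset.Ici) (t' := Finset.univ) (s' := Finset.Iic)
      (by simp)]
  ring

theorem region_eq_dualRegion (N : RelayNetwork tx rx ant) (PT : ℝ) :
    N.region PT = N.dualRegion PT := by
  ext ρ
  constructor
  · rintro ⟨h0, S, F, hS, hc, hρ⟩
    have hN := N.regular_equivalentIFN F
    obtain ⟨st⟩ := hN.nonempty_streams N.rx_pos hS
    refine ⟨h0, st.covTransform, F.adjoint, st.posSemidef_covTransform hN, ?_, fun l => ?_⟩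
    · rwa [dualCost_adjoint, st.dual_cost_covTransform hN, ← cost_eq]
    · rw [dualRate_adjoint]
      exact (hρ l).trans (st.rate_le_dual_rate hN l)
  · rintro ⟨h0, Sh, Fh, hS, hc, hρ⟩
    obtain ⟨F, rfl⟩ : ∃ F : Precoders ant, F.adjoint = Fh := ⟨Fh.adjoint, Fh.adjoint_adjoint⟩
    have hN := (N.regular_equivalentIFN F).dual
    -- The transformation is now applied to the dual one-hop network, whose receivers are the
    -- sources.
    obtain ⟨st⟩ := hN.nonempty_streams N.tx_pos hS
    have hcost := st.dual_cost_covTransform hN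
    have hrate := st.rate_le_dual_rate hN
    rw [IFN.dual_dual] at hcost hrate
    refine ⟨h0, st.covTransform, F, st.posSemidef_covTransform hN, ?_, fun l => ?_⟩
    · rwa [cost_eq, hcost, ← dualCost_adjoint]
    · have := hρ l
      rw [dualRate_adjoint] at this
      exact this.trans (hrate l)

end RelayNetwork

theorem mainTheorem1 {L n : ℕ} {tx rx : Fin L → ℕ} {relays : Fin (n + 1) → ℕ}
    {ant : ∀ q, Fin (relays q) → ℕ} (N : RelayNetwork tx rx ant) (PT : ℝ) :
    (∀ (S : Covariances tx) (F : Precoders ant),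
      (∀ l, (S l).PosSemidef) → N.cost S F ≤ PT →
        Nonempty (Streams (N.equivalentIFN F) S) ∧
        ∀ st : Streams (N.equivalentIFN F) S,
          IsUnit (st.D⁻¹ - st.Psiᵀ) ∧
          (∀ a, 0 ≤ st.q a) ∧
          (∀ l, (st.covTransform l).PosSemidef) ∧
          (∀ l, N.rate S F l ≤ N.dualRate st.covTransform F.adjoint l) ∧
          N.dualCost st.covTransform F.adjoint = N.cost S F) ∧
    N.region PT = N.dualRegion PT := by
  refine ⟨fun S F hS _ => ?_, N.region_eq_dualRegion PT⟩
  have hN := N.regular_equivalentIFN F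
  refine ⟨hN.nonempty_streams N.rx_pos hS, fun st => ⟨st.isUnit_sub hN, st.q_nonneg hN,
    st.posSemidef_covTransform hN, fun l => ?_, ?_⟩⟩
  · rw [N.dualRate_adjoint]
    exact st.rate_le_dual_rate hN l
  · rw [N.dualCost_adjoint, st.dual_cost_covTransform hN, ← N.cost_eq]
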